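/- Let $P$ and $Q$ be probability measures on a common measurable space, with $P \ll Q$, and suppose that $\frac{\mathrm{d}P}{\mathrm{d}Q}$ is $Q$-essentially bounded, i.e., $\operatorname{ess\,sup} \frac{\mathrm{d}P}{\mathrm{d}Q}(Y) < \infty$ for $Y \sim Q$. Let $\log$ denote the logarithm to an arbitrary fixed base $b > 1$, with $\log 0 = -\infty$ and $\log \infty = \infty$. For probability measures $\mu, \nu$ with densities $m, n$ with respect to $\mu + \nu$, and for $\alpha \in (0,1)\cup(1,\infty)$, let $$\mathscr{H}_\alpha(\mu\|\nu) = D_{f_\alpha}(\mu\|\nu) = \int n \, f_\alpha\Bigl(\frac{m}{n}\Bigr) \, \mathrm{d}(\mu+\nu), \qquad f_\alpha(t) = \frac{t^\alpha - 1}{\alpha - 1},$$ be the Hellinger divergence of order $\alpha$ (with the usual conventions $f(0) = \lim_{t \downarrow 0} f(t)$, $0 f(0/0) = 0$ and $0 f(a/0) = a \lim_{u\to\infty} f(u)/u$ for $a>0$), let $\chi^2(\mu\|\nu) = \mathscr{H}_2(\mu\|\nu)$ be the chi-squared divergence, and let $D_\alpha(\mu\|\nu)$ be the Rényi divergence of order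 $\alpha \in [0,\infty]$: $$D_\alpha(\mu\|\nu) = \frac{1}{\alpha-1} \log\bigl(1 + (\alpha-1) \mathscr{H}_\alpha(\mu\|\nu)\bigr), \quad \alpha \in (0,1)\cup(1,\infty),$$ $D_0(\mu\|\nu) = -\log \nu(m > 0)$, $D_1(\mu\|\nu)$ is the relative entropy, and $D_\infty(\mu\|\nu) = \log\bigl(\operatorname{ess\,sup}_\mu \frac{m}{n}\bigr)$. Then, for every $\alpha \in [0,\infty]$, $$\lim_{\lambda\downarrow 0} \frac{1}{\lambda^2} D_\alpha(\lambda P + (1-\lambda) Q \,\|\, Q) = \lim_{\lambda\downarrow 0} \frac{1}{\lambda^2} D_\alpha(Q \,\|\, \lambda P + (1-\lambda) Q) = \tfrac12 \, \alpha \, \chi^2(P\|Q) \log e,$$ where both limits exist in $[0,\infty]$ and, for $\alpha = \infty$, $\infty \cdot 0 = 0$. -/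

import Mathlib

open MeasureTheory Filter Topology Set
open scoped ENNReal

noncomputable section

namespace FDivergence

variable {A : Type*} [MeasurableSpace A]

/-- Integral of an extended-real-valued function: the integral of its positive part minus the
integral of its negative part. (In an `f`-divergence with convex `f` the second one is finite.) -/
def eintegral (μ : Measure A) (g : A → EReal) : EReal :=
  ((∫⁻ a, (g a).toENNReal ∂μ : ℝ≥0∞) : EReal) - ((∫⁻ a, (-g a).toENNReal ∂μ : ℝ≥0∞) : EReal)

/-- The value `f(0) = lim_{t ↓ 0} f(t)` of a function `f` on `(0, ∞)`. -/
def valueAtZero (f : ℝ → ℝ) : EReal :=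
  limUnder (𝓝[>] (0 : ℝ)) (fun t => ((f t : ℝ) : EReal))

/-- The limit `lim_{u → ∞} f(u) / u`. -/
def slopeAtTop (f : ℝ → ℝ) : EReal :=
  limUnder (atTop : Filter ℝ) (fun u => ((f u / u : ℝ) : EReal))

/-- The integrand `q f(p / q)` for `p, q ≥ 0`, with the conventions `f(0) = lim_{t ↓ 0} f(t)`,
`0 f(0 / 0) = 0` and `0 f(p / 0) = p lim_{u → ∞} f(u) / u` for `p > 0`. -/
def perspective (f : ℝ → ℝ) (p q : ℝ) : EReal :=
  if q = 0 then
    (if p = 0 then 0 else (p : EReal) * slopeAtTop f)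
  else
    (if p = 0 then (q : EReal) * valueAtZero f else ((q * f (p / q) : ℝ) : EReal))

/-- The `f`-divergence `D_f(P‖Q) = ∫ q f(p / q) dμ`, where `p = dP/dμ`, `q = dQ/dμ`, written with
the dominating measure `μ = P + Q`. -/
def fDiv (f : ℝ → ℝ) (P Q : Measure A) : EReal :=
  eintegral (P + Q)
    (fun a => perspective f (P.rnDeriv (P + Q) a).toReal (Q.rnDeriv (P + Q) a).toReal)

/-- The Hellinger divergence of order `α ∈ (0, 1) ∪ (1, ∞)`: the `f`-divergence with
`f(t) = (t ^ α - 1) / (α - 1)`. -/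
def hellingerDiv (α : ℝ) (P Q : Measure A) : EReal :=
  fDiv (fun t => (t ^ α - 1) / (α - 1)) P Q

/-- The chi-squared divergence: the Hellinger divergence of order `2`. -/
def chiSqDiv (P Q : Measure A) : EReal := hellingerDiv 2 P Q

/-- The logarithm to base `b`, extended to `[0, ∞]` by `log 0 = -∞` and `log ∞ = ∞`. -/
def elogb (b : ℝ) (x : ℝ≥0∞) : EReal := ((Real.log b)⁻¹ : ℝ) * ENNReal.log x

/-- The Rényi divergence `D_α(P‖Q)` of order `α ∈ [0, ∞]`, with logarithms to base `b`:
* `D_0(P‖Q) = -log Q(p > 0)`;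
* `D_1(P‖Q)` is the relative entropy (`klDiv` uses natural logarithms, hence the factor `log e`);
* `D_∞(P‖Q) = log (ess sup p / q)`, the essential supremum being with respect to `P`;
* `D_α(P‖Q) = (α - 1)⁻¹ log (1 + (α - 1) H_α(P‖Q))` for `α ∈ (0, 1) ∪ (1, ∞)`, where `H_α` is the
  Hellinger divergence.
Here `p` and `q` are the densities of `P` and `Q` with respect to `P + Q`. -/
def renyiDiv (b : ℝ) (α : ℝ≥0∞) (P Q : Measure A) : EReal :=
  if α = 0 then
    -elogb b (Q {a | 0 < P.rnDeriv (P + Q) a})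
  else if α = 1 then
    ((Real.logb b (Real.exp 1) : ℝ) : EReal) * ((InformationTheory.klDiv P Q : ℝ≥0∞) : EReal)
  else if α = ∞ then
    elogb b (essSup (fun a => P.rnDeriv (P + Q) a / Q.rnDeriv (P + Q) a) P)
  else
    (((α.toReal - 1)⁻¹ : ℝ) : EReal) *
      elogb b ((1 + ((α.toReal - 1 : ℝ) : EReal) * hellingerDiv α.toReal P Q).toENNReal)

/-- The mixture `t P + (1 - t) Q`, for `t ∈ [0, 1]`. -/
def mixture (t : ℝ) (P Q : Measure A) : Measure A :=
  ENNReal.ofReal t • P + ENNReal.ofReal (1 - t) • Q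

end FDivergence

end

noncomputable section

namespace FDivergence

variable {A : Type*} [MeasurableSpace A]

/-! Write `P = g Q` with `g` bounded and put `u = g - 1`, which is bounded with `Q`-mean zero. The
mixture is then `R_t = (1 + t u) Q`, and for small `t` the factor `1 + t u` lies in `[1/2, 3/2]`
everywhere, so `Q` and `R_t` are mutually absolutely continuous with densities bounded away from `0`
and `∞`. Also `χ²(P‖Q) = ∫ u² dQ`.

For finite `α ≠ 0`, both divergences are functions of some `∫ φ(1 + t u) dQ`. With `R_t` on the
left, `φ` is `x ^ α` or `x log x - x + 1`; with `R_t` on the right, a change of measure turns `φ`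
into `x ^ (1 - α)` or `x - 1 - log x`. Boundedness of `u` makes the Taylor expansion at `1` uniform,
and the linear term integrates to zero, so the integral is `φ(1) + (φ''(1)/2) t² ∫ u² + o(t²)`
(`tendsto_integral_second_order`). The exponents `α` and `1 - α` give the same `φ''(1) = α(α - 1)`;
after the logarithm and division by `α - 1` both sides yield `α/2`. At `α = 0` the divergences
vanish because the densities are positive.

For `α = ∞` the divergence is the logarithm of an essential supremum, of first order in `t` unless
`u = 0` a.e.; dividing by `t²` gives `∞` (`tendsto_coe_mul_top`). If `u = 0` a.e., everything is
zero. -/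

theorem withDensity_ofReal_mul (ν : Measure A) {f g : A → ℝ} (hf : Measurable f)
    (hg : Measurable g) (hf0 : ∀ a, 0 ≤ f a) :
    (ν.withDensity fun a => ENNReal.ofReal (f a)).withDensity (fun a => ENNReal.ofReal (g a)) =
      ν.withDensity fun a => ENNReal.ofReal (f a * g a) := by
  rw [← withDensity_mul _ hf.ennreal_ofReal hg.ennreal_ofReal]
  congr 1
  ext a
  simp [ENNReal.ofReal_mul (hf0 a)]

theorem withDensity_ofReal_add_self (ν : Measure A) {k : A → ℝ} (hk0 : ∀ a, 0 ≤ k a) :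
    (ν.withDensity fun a => ENNReal.ofReal (k a)) + ν =
      ν.withDensity fun a => ENNReal.ofReal (1 + k a) := by
  have h : (fun a => ENNReal.ofReal (1 + k a)) = 1 + fun a => ENNReal.ofReal (k a) := by
    ext a
    simp [ENNReal.ofReal_add zero_le_one (hk0 a)]
  rw [h, withDensity_add_left measurable_one, withDensity_one, add_comm]

theorem integrable_withDensity_ofReal_iff (ν : Measure A) {k f : A → ℝ} (hk : Measurable k)
    (hk0 : ∀ a, 0 ≤ k a) :
    Integrable f (ν.withDensity fun a => ENNReal.ofReal (k a)) ↔
      Integrable (fun a => k a * f a) ν := by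
  rw [integrable_withDensity_iff_integrable_smul' hk.ennreal_ofReal (by simp)]
  simp [ENNReal.toReal_ofReal, hk0]

theorem integral_withDensity_ofReal (ν : Measure A) {k : A → ℝ} (f : A → ℝ) (hk : Measurable k)
    (hk0 : ∀ a, 0 ≤ k a) :
    ∫ a, f a ∂(ν.withDensity fun a => ENNReal.ofReal (k a)) = ∫ a, k a * f a ∂ν := by
  rw [integral_withDensity_eq_integral_toReal_smul hk.ennreal_ofReal (by simp)]
  simp [ENNReal.toReal_ofReal, hk0]

/-! ### Divergences of `k ν` from `ν` in terms of `k` -/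

section RnDeriv

variable {ν : Measure A} [IsFiniteMeasure ν] {k : A → ℝ}

theorem rnDeriv_withDensity_add (hk : Measurable k) (hk0 : ∀ a, 0 ≤ k a) :
    (ν.withDensity fun a => ENNReal.ofReal (k a)).rnDeriv
      ((ν.withDensity fun a => ENNReal.ofReal (k a)) + ν)
      =ᵐ[(ν.withDensity fun a => ENNReal.ofReal (k a)) + ν]
        fun a => ENNReal.ofReal (k a / (1 + k a)) := by
  have h1 : ∀ a, 0 < 1 + k a := fun a => by linarith [hk0 a]
  have hm : Measurable fun a => 1 + k a := by fun_prop
  rw [withDensity_ofReal_add_self ν hk0]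
  have : (ν.withDensity fun a => ENNReal.ofReal (k a)) =
      (ν.withDensity fun a => ENNReal.ofReal (1 + k a)).withDensity
        fun a => ENNReal.ofReal (k a / (1 + k a)) := by
    rw [withDensity_ofReal_mul ν hm (g := fun a => k a / (1 + k a)) (hk.div hm) fun a => (h1 a).le]
    congr 1
    ext a
    rw [mul_div_cancel₀ _ (h1 a).ne']
  rw [this]
  have : SigmaFinite (ν.withDensity fun a => ENNReal.ofReal (1 + k a)) :=
    SigmaFinite.withDensity_ofReal _
  exact Measure.rnDeriv_withDensity _ (hk.div hm).ennreal_ofReal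

theorem rnDeriv_self_withDensity_add (hk : Measurable k) (hk0 : ∀ a, 0 ≤ k a) :
    ν.rnDeriv ((ν.withDensity fun a => ENNReal.ofReal (k a)) + ν)
      =ᵐ[(ν.withDensity fun a => ENNReal.ofReal (k a)) + ν]
        fun a => ENNReal.ofReal (1 / (1 + k a)) := by
  have h1 : ∀ a, 0 < 1 + k a := fun a => by linarith [hk0 a]
  have hm : Measurable fun a => 1 + k a := by fun_prop
  rw [withDensity_ofReal_add_self ν hk0]
  have h : ν = (ν.withDensity fun a => ENNReal.ofReal (1 + k a)).withDensity
        fun a => ENNReal.ofReal (1 / (1 + k a)) := by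
    rw [withDensity_ofReal_mul ν hm (g := fun a => 1 / (1 + k a)) (measurable_const.div hm)
      fun a => (h1 a).le]
    conv_lhs => rw [← withDensity_one (μ := ν)]
    congr 1
    ext a
    rw [mul_div_cancel₀ _ (h1 a).ne']
    simp
  have : SigmaFinite (ν.withDensity fun a => ENNReal.ofReal (1 + k a)) :=
    SigmaFinite.withDensity_ofReal _
  have hd := Measure.rnDeriv_withDensity (ν.withDensity fun a => ENNReal.ofReal (1 + k a))
    (f := fun a => ENNReal.ofReal (1 / (1 + k a))) (measurable_const.div hm).ennreal_ofReal
  rwa [← h] at hd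

end RnDeriv

theorem eintegral_coe {μ : Measure A} {g : A → ℝ} (hg : Integrable g μ) :
    eintegral μ (fun a => (g a : EReal)) = ((∫ a, g a ∂μ : ℝ) : EReal) := by
  have h1 : ∫⁻ a, ENNReal.ofReal (g a) ∂μ ≠ ∞ := hg.lintegral_lt_top.ne
  have h2 : ∫⁻ a, ENNReal.ofReal (-g a) ∂μ ≠ ∞ := hg.neg.lintegral_lt_top.ne
  rw [integral_eq_lintegral_pos_part_sub_lintegral_neg_part hg, eintegral, EReal.coe_sub,
    EReal.coe_ennreal_toReal h1, EReal.coe_ennreal_toReal h2]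
  rfl

theorem eintegral_congr {μ : Measure A} {f g : A → EReal} (h : f =ᵐ[μ] g) :
    eintegral μ f = eintegral μ g := by
  unfold eintegral
  congr 2
  · exact lintegral_congr_ae (h.mono fun a ha => by simp only [ha])
  · exact lintegral_congr_ae (h.mono fun a ha => by simp only [ha])

/-- The densities with respect to the sum are `k / (1 + k)` and `1 / (1 + k)`; their ratio is `k`,
and the factor `1 / (1 + k)` cancels against the density `1 + k` of the sum. The limit value at zero
matters only where `k` vanishes: perturbed densities avoid this, but the density of `P` itself may
not. -/
theorem fDiv_withDensity {ν : Measure A} [IsFiniteMeasure ν] {k : A → ℝ} {f : ℝ → ℝ}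
    (hk : Measurable k) (hk0 : ∀ a, 0 ≤ k a) (hf : Integrable (fun a => f (k a)) ν)
    (hf0 : (∀ a, 0 < k a) ∨ valueAtZero f = f 0) :
    fDiv f (ν.withDensity fun a => ENNReal.ofReal (k a)) ν =
      ((∫ a, f (k a) ∂ν : ℝ) : EReal) := by
  have h1 : ∀ a, 0 < 1 + k a := fun a => by linarith [hk0 a]
  have hm : Measurable fun a => 1 + k a := by fun_prop
  have hcongr : (fun a => perspective f
      (((ν.withDensity fun a => ENNReal.ofReal (k a)).rnDeriv
        ((ν.withDensity fun a => ENNReal.ofReal (k a)) + ν) a).toReal)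
      ((ν.rnDeriv ((ν.withDensity fun a => ENNReal.ofReal (k a)) + ν) a).toReal))
      =ᵐ[(ν.withDensity fun a => ENNReal.ofReal (k a)) + ν]
      fun a => ((1 / (1 + k a) * f (k a) : ℝ) : EReal) := by
    filter_upwards [rnDeriv_withDensity_add (ν := ν) hk hk0,
      rnDeriv_self_withDensity_add (ν := ν) hk hk0] with a ha hb
    have hq : 0 < 1 / (1 + k a) := one_div_pos.2 (h1 a)
    have hp : 0 ≤ k a / (1 + k a) := div_nonneg (hk0 a) (h1 a).le
    rw [ha, hb, ENNReal.toReal_ofReal hp, ENNReal.toReal_ofReal hq.le, perspective,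
      if_neg hq.ne']
    split_ifs with h
    · have hka : k a = 0 := by
        rcases div_eq_zero_iff.1 h with h | h
        · exact h
        · exact absurd h (h1 a).ne'
      rcases hf0 with hf0 | hf0
      · exact absurd hka (hf0 a).ne'
      · rw [hf0, hka, EReal.coe_mul]
    · congr 3
      field_simp [(h1 a).ne']
  have heq : (fun a => (1 + k a) * (1 / (1 + k a) * f (k a))) = fun a => f (k a) := by
    ext a
    field_simp [(h1 a).ne']
  rw [fDiv, eintegral_congr hcongr, withDensity_ofReal_add_self ν hk0, eintegral_coe,
    integral_withDensity_ofReal ν _ hm fun a => (h1 a).le, heq]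
  rw [integrable_withDensity_ofReal_iff ν hm fun a => (h1 a).le, heq]
  exact hf

theorem elogb_ofReal {b x : ℝ} (hx : 0 < x) :
    elogb b (ENNReal.ofReal x) = ((Real.logb b x : ℝ) : EReal) := by
  rw [elogb, ENNReal.log_ofReal_of_pos hx, ← EReal.coe_mul, Real.logb, div_eq_inv_mul]

section Renyi

variable {ν : Measure A} [IsProbabilityMeasure ν] {k : A → ℝ} {b : ℝ}

theorem renyiDiv_withDensity_zero (hk : Measurable k) (hk0 : ∀ a, 0 < k a) :
    renyiDiv b 0 (ν.withDensity fun a => ENNReal.ofReal (k a)) ν = 0 := by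
  have h : ∀ᵐ a ∂ν, 0 < (ν.withDensity fun a => ENNReal.ofReal (k a)).rnDeriv
      ((ν.withDensity fun a => ENNReal.ofReal (k a)) + ν) a := by
    have := rnDeriv_withDensity_add (ν := ν) hk fun a => (hk0 a).le
    filter_upwards [(Measure.absolutelyContinuous_of_le (Measure.le_add_left le_rfl)).ae_le this]
      with a ha
    rw [ha, ENNReal.ofReal_pos]
    exact div_pos (hk0 a) (by linarith [hk0 a])
  rw [renyiDiv, if_pos rfl]
  have h2 : ν {a | 0 < (ν.withDensity fun a => ENNReal.ofReal (k a)).rnDeriv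
      ((ν.withDensity fun a => ENNReal.ofReal (k a)) + ν) a} = 1 := by
    rw [← measure_univ (μ := ν)]
    exact measure_congr (eventuallyEq_univ.2 h)
  rw [h2]
  simp [elogb]

theorem renyiDiv_withDensity_one (hk : Measurable k) (hk0 : ∀ a, 0 < k a)
    (hint : Integrable (fun a => InformationTheory.klFun (k a)) ν)
    [IsFiniteMeasure (ν.withDensity fun a => ENNReal.ofReal (k a))] :
    renyiDiv b 1 (ν.withDensity fun a => ENNReal.ofReal (k a)) ν =
      ((Real.logb b (Real.exp 1) * ∫ a, InformationTheory.klFun (k a) ∂ν : ℝ) : EReal) := by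
  have h : InformationTheory.klDiv (ν.withDensity fun a => ENNReal.ofReal (k a)) ν =
      ENNReal.ofReal (∫ a, InformationTheory.klFun (k a) ∂ν) := by
    rw [InformationTheory.klDiv_eq_lintegral_klFun_of_ac (withDensity_absolutelyContinuous _ _),
      ofReal_integral_eq_lintegral_ofReal hint
        (ae_of_all _ fun a => InformationTheory.klFun_nonneg (hk0 a).le)]
    refine lintegral_congr_ae ?_
    filter_upwards [Measure.rnDeriv_withDensity ν hk.ennreal_ofReal] with a ha
    rw [ha, ENNReal.toReal_ofReal (hk0 a).le]
  rw [renyiDiv, if_neg one_ne_zero, if_pos rfl, h, EReal.coe_mul, EReal.coe_ennreal_ofReal,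
    max_eq_left]
  exact integral_nonneg fun a => InformationTheory.klFun_nonneg (hk0 a).le

/-- Positivity of `k` makes the two measures have the same null sets, so the essential supremum may
be taken under either. -/
theorem renyiDiv_withDensity_top (hk : Measurable k) (hk0 : ∀ a, 0 < k a) :
    renyiDiv b ∞ (ν.withDensity fun a => ENNReal.ofReal (k a)) ν =
      elogb b (essSup (fun a => ENNReal.ofReal (k a)) ν) := by
  rw [renyiDiv, if_neg (by simp), if_neg (by simp), if_pos rfl]
  have hac : ν.withDensity (fun a => ENNReal.ofReal (k a)) ≪
      (ν.withDensity fun a => ENNReal.ofReal (k a)) + ν :=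
    Measure.absolutelyContinuous_of_le (Measure.le_add_right le_rfl)
  have hac' : ν ≪ ν.withDensity fun a => ENNReal.ofReal (k a) :=
    withDensity_absolutelyContinuous' hk.ennreal_ofReal.aemeasurable
      (ae_of_all _ fun a => (ENNReal.ofReal_pos.2 (hk0 a)).ne')
  congr 1
  rw [essSup_congr_ae (g := fun a => ENNReal.ofReal (k a))]
  · exact le_antisymm (essSup_mono_measure (withDensity_absolutelyContinuous _ _))
      (essSup_mono_measure hac')
  · filter_upwards [hac.ae_le (rnDeriv_withDensity_add (ν := ν) hk fun a => (hk0 a).le),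
      hac.ae_le (rnDeriv_self_withDensity_add (ν := ν) hk fun a => (hk0 a).le)] with a ha hb
    have h1 : 0 < 1 + k a := by linarith [hk0 a]
    rw [ha, hb, ← ENNReal.ofReal_div_of_pos (one_div_pos.2 h1)]
    congr 1
    field_simp

theorem renyiDiv_withDensity {α : ℝ≥0∞} (h0 : α ≠ 0) (h1 : α ≠ 1) (ht : α ≠ ∞)
    (hk : Measurable k) (hk0 : ∀ a, 0 < k a)
    (hint : Integrable (fun a => k a ^ α.toReal) ν) (hpos : 0 < ∫ a, k a ^ α.toReal ∂ν) :
    renyiDiv b α (ν.withDensity fun a => ENNReal.ofReal (k a)) ν =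
      (((α.toReal - 1)⁻¹ * Real.logb b (∫ a, k a ^ α.toReal ∂ν) : ℝ) : EReal) := by
  have hα : α.toReal - 1 ≠ 0 := by
    rw [sub_ne_zero]
    simpa [ENNReal.toReal_eq_one_iff] using h1
  rw [renyiDiv, if_neg h0, if_neg h1, if_neg ht, hellingerDiv,
    fDiv_withDensity hk (fun a => (hk0 a).le) ((hint.sub (integrable_const 1)).div_const _)
      (Or.inl hk0)]
  have : (1 + ((α.toReal - 1 : ℝ) : EReal) *
      ((∫ a, (k a ^ α.toReal - 1) / (α.toReal - 1) ∂ν : ℝ) : EReal)) =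
      ((∫ a, k a ^ α.toReal ∂ν : ℝ) : EReal) := by
    rw [integral_div, integral_sub hint (integrable_const 1), ← EReal.coe_mul,
      mul_div_cancel₀ _ hα, ← EReal.coe_one, ← EReal.coe_add]
    simp
  rw [this, EReal.toENNReal_of_ne_top (EReal.coe_ne_top _), EReal.toReal_coe, elogb_ofReal hpos,
    ← EReal.coe_mul]

end Renyi

/-! ### Second-order expansions -/

/-- The remainder has derivative `φ' x - φ' 1 - c (x - 1) = o(x - 1)`, and a mean value estimate on
the convex set `(0, ∞)` gains one power. A second derivative is needed only at `1`. -/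
theorem isLittleO_second_order {φ φ' : ℝ → ℝ} {c : ℝ} (h1 : ∀ x, 0 < x → HasDerivAt φ (φ' x) x)
    (h2 : HasDerivAt φ' c 1) :
    (fun x => φ x - φ 1 - φ' 1 * (x - 1) - c / 2 * (x - 1) ^ 2) =o[𝓝 1]
      fun x => (x - 1) ^ 2 := by
  have key := (convex_Ioi (0 : ℝ)).isLittleO_pow_succ_real (x₀ := 1) (n := 1)
    (f := fun x => φ x - φ' 1 * (x - 1) - c / 2 * (x - 1) ^ 2)
    (f' := fun x => φ' x - φ' 1 - c * (x - 1)) (by simp) ?_ ?_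
  · rw [nhdsWithin_eq_nhds.2 (Ioi_mem_nhds one_pos)] at key
    refine key.congr_left fun x => ?_
    ring
  · intro x hx
    have e := ((hasDerivAt_id x).sub_const 1)
    have := ((h1 x hx).sub (e.const_mul (φ' 1))).sub ((e.pow 2).const_mul (c / 2))
    refine (this.congr_deriv ?_).hasDerivWithinAt
    simp
    ring
  · rw [nhdsWithin_eq_nhds.2 (Ioi_mem_nhds one_pos)]
    have := h2.isLittleO
    simp only [pow_one]
    refine this.congr_left fun x => ?_
    simp [mul_comm]

/-- Second order expansion of `t ↦ ∫ φ (1 + t u)` at `0`, for a bounded `u` of mean zero. -/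
theorem tendsto_integral_second_order {Q : Measure A} [IsProbabilityMeasure Q] {u : A → ℝ} {M : ℝ}
    (hu : Measurable u) (hM : ∀ a, |u a| ≤ M) (hu0 : ∫ a, u a ∂Q = 0)
    {φ φ' : ℝ → ℝ} {c : ℝ} (h1 : ∀ x, 0 < x → HasDerivAt φ (φ' x) x)
    (h2 : HasDerivAt φ' c 1)
    (hint : ∀ᶠ t in 𝓝[>] (0 : ℝ), Integrable (fun a => φ (1 + t * u a)) Q) :
    Tendsto (fun t : ℝ => (∫ a, φ (1 + t * u a) ∂Q - φ 1) / t ^ 2) (𝓝[>] 0)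
      (𝓝 (c / 2 * ∫ a, u a ^ 2 ∂Q)) := by
  have hui : Integrable u Q := Integrable.of_bound hu.aestronglyMeasurable M (ae_of_all _ hM)
  have hui2 : Integrable (fun a => u a ^ 2) Q :=
    Integrable.of_bound (hu.pow_const 2).aestronglyMeasurable (M ^ 2) (ae_of_all _ fun a => by
      rw [norm_pow]; exact pow_le_pow_left₀ (norm_nonneg _) (hM a) 2)
  set s := ∫ a, u a ^ 2 ∂Q with hs
  have hs0 : 0 ≤ s := integral_nonneg fun a => sq_nonneg _
  rw [Metric.tendsto_nhds]
  intro ε hε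
  -- The `+ 1` allows `s = 0` and makes the final bound `ε s / (s + 1)` strictly less than `ε`.
  have hε' : 0 < ε / (s + 1) := by positivity
  obtain ⟨δ, hδ, hball⟩ := Metric.eventually_nhds_iff.1
    ((isLittleO_second_order h1 h2).bound hε')
  -- Since `|t u| ≤ t M`, a single threshold puts every point `1 + t u a` in the ball where the
  -- Taylor bound holds.
  have hsmall : ∀ᶠ t in 𝓝[>] (0 : ℝ), t * M < δ := by
    have : Tendsto (fun t : ℝ => t * M) (𝓝[>] 0) (𝓝 (0 * M)) :=
      (tendsto_id.mul_const M).mono_left nhdsWithin_le_nhds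
    rw [zero_mul] at this
    exact this.eventually (gt_mem_nhds hδ)
  filter_upwards [hint, hsmall, self_mem_nhdsWithin] with t hi ht ht0
  have ht0 : 0 < t := ht0
  have hrem : ∀ a, ‖φ (1 + t * u a) - φ 1 - φ' 1 * (t * u a) - c / 2 * (t * u a) ^ 2‖ ≤
      ε / (s + 1) * t ^ 2 * u a ^ 2 := by
    intro a
    have := @hball (1 + t * u a) (by
      rw [Real.dist_eq, add_sub_cancel_left, abs_mul, abs_of_pos ht0]
      exact (mul_le_mul_of_nonneg_left (hM a) ht0.le).trans_lt ht)
    rw [add_sub_cancel_left] at this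
    refine this.trans_eq ?_
    rw [Real.norm_of_nonneg (sq_nonneg _)]
    ring
  have hI : ∫ a, (φ (1 + t * u a) - φ 1 - φ' 1 * (t * u a) - c / 2 * (t * u a) ^ 2) ∂Q =
      ∫ a, φ (1 + t * u a) ∂Q - φ 1 - c / 2 * t ^ 2 * s := by
    have e1 : Integrable (fun a => φ' 1 * (t * u a)) Q := (hui.const_mul t).const_mul _
    have e2 : Integrable (fun a => c / 2 * (t * u a) ^ 2) Q := by
      simp_rw [mul_pow]
      exact (hui2.const_mul _).const_mul _
    have e3 : Integrable (fun a => φ (1 + t * u a) - φ 1) Q := hi.sub (integrable_const _)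
    have e4 : Integrable (fun a => φ (1 + t * u a) - φ 1 - φ' 1 * (t * u a)) Q := e3.sub e1
    rw [integral_sub e4 e2, integral_sub e3 e1, integral_sub hi (integrable_const _)]
    simp_rw [mul_pow, integral_const_mul, hu0]
    simp [← hs]
    ring
  have hb : ‖∫ a, φ (1 + t * u a) ∂Q - φ 1 - c / 2 * t ^ 2 * s‖ ≤ ε / (s + 1) * t ^ 2 * s := by
    rw [← hI, hs, ← integral_const_mul]
    exact norm_integral_le_of_norm_le (hui2.const_mul _) (ae_of_all _ hrem)
  have ht2 : 0 < t ^ 2 := by positivity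
  have hd : (∫ a, φ (1 + t * u a) ∂Q - φ 1) / t ^ 2 - c / 2 * s =
      (∫ a, φ (1 + t * u a) ∂Q - φ 1 - c / 2 * t ^ 2 * s) / t ^ 2 := by
    field_simp
  rw [Real.dist_eq, hd, abs_div, abs_of_pos ht2, div_lt_iff₀ ht2]
  refine (Real.norm_eq_abs _ ▸ hb).trans_lt ?_
  have : ε / (s + 1) * s < ε := by
    rw [div_mul_eq_mul_div, div_lt_iff₀ (by positivity)]
    nlinarith
  nlinarith

/-- Squeeze with `1 - 1 / L ≤ log L ≤ L - 1`; the hypotheses force `L → 1`, so both bounds have the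
same limit after division by `r`. -/
theorem tendsto_log_div_of_tendsto_sub_one_div {l : Filter ℝ} {L r : ℝ → ℝ} {c : ℝ}
    (hr : Tendsto r l (𝓝 0)) (hr0 : ∀ᶠ t in l, 0 < r t)
    (h : Tendsto (fun t => (L t - 1) / r t) l (𝓝 c)) :
    Tendsto (fun t => Real.log (L t) / r t) l (𝓝 c) ∧ ∀ᶠ t in l, 0 < L t := by
  have hL : Tendsto L l (𝓝 1) := by
    have h' := (h.mul hr).add_const 1
    simp only [mul_zero, zero_add] at h'
    refine h'.congr' ?_
    filter_upwards [hr0] with t ht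
    field_simp
    ring
  have hpos : ∀ᶠ t in l, 0 < L t := hL.eventually (lt_mem_nhds one_pos)
  refine ⟨?_, hpos⟩
  have hlow : Tendsto (fun t => (L t - 1) / r t * (L t)⁻¹) l (𝓝 c) := by
    simpa using h.mul (hL.inv₀ one_ne_zero)
  refine tendsto_of_tendsto_of_tendsto_of_le_of_le' hlow h ?_ ?_
  · filter_upwards [hpos, hr0] with t h1 h2
    have := Real.one_sub_inv_le_log_of_pos h1
    rw [div_mul_eq_mul_div, sub_mul, one_mul, mul_inv_cancel₀ h1.ne']
    exact div_le_div_of_nonneg_right this h2.le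
  · filter_upwards [hpos, hr0] with t h1 h2
    exact div_le_div_of_nonneg_right (Real.log_le_sub_one_of_pos h1) h2.le

/-! ### Reduction to a bounded density, and tools for order `∞` -/

theorem exists_bounded_density {P Q : Measure A} [IsFiniteMeasure P] [SigmaFinite Q]
    (hPQ : P ≪ Q) (hbdd : essSup (P.rnDeriv Q) Q < ∞) :
    ∃ (g : A → ℝ) (M : ℝ), Measurable g ∧ (∀ a, 0 ≤ g a) ∧ (∀ a, g a ≤ M) ∧
      P = Q.withDensity fun a => ENNReal.ofReal (g a) := by
  -- Truncating at the essential supremum changes the density only on a null set and makes the bound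
  -- hold everywhere.
  refine ⟨fun a => min (P.rnDeriv Q a).toReal (essSup (P.rnDeriv Q) Q).toReal,
    (essSup (P.rnDeriv Q) Q).toReal, (Measure.measurable_rnDeriv P Q).ennreal_toReal.min
      measurable_const, fun a => le_min ENNReal.toReal_nonneg ENNReal.toReal_nonneg,
    fun a => min_le_right _ _, ?_⟩
  conv_lhs => rw [← Measure.withDensity_rnDeriv_eq P Q hPQ]
  refine withDensity_congr_ae ?_
  filter_upwards [ENNReal.ae_le_essSup (P.rnDeriv Q)] with a ha
  rw [min_eq_left (ENNReal.toReal_mono hbdd.ne ha), ENNReal.ofReal_toReal (ha.trans_lt hbdd).ne]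

theorem mixture_withDensity (Q : Measure A) {g : A → ℝ} (hg : Measurable g) (hg0 : ∀ a, 0 ≤ g a)
    {t : ℝ} (ht0 : 0 ≤ t) (ht1 : t ≤ 1) :
    mixture t (Q.withDensity fun a => ENNReal.ofReal (g a)) Q =
      Q.withDensity fun a => ENNReal.ofReal (1 + t * (g a - 1)) := by
  have h : (fun a => ENNReal.ofReal (1 + t * (g a - 1))) =
      (ENNReal.ofReal t • fun a => ENNReal.ofReal (g a)) + fun _ => ENNReal.ofReal (1 - t) := by
    ext a
    rw [Pi.add_apply, Pi.smul_apply, smul_eq_mul, ← ENNReal.ofReal_mul ht0,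
      ← ENNReal.ofReal_add (mul_nonneg ht0 (hg0 a)) (sub_nonneg.2 ht1)]
    congr 1
    ring
  rw [h, withDensity_add_right _ measurable_const, withDensity_const,
    withDensity_smul _ hg.ennreal_ofReal, mixture]

theorem le_essSup_of_measure_ne_zero {μ : Measure A} {f : A → ℝ≥0∞} {c : ℝ≥0∞} {s : Set A}
    (hs : μ s ≠ 0) (h : ∀ a ∈ s, c ≤ f a) : c ≤ essSup f μ := by
  by_contra hc
  refine hs (measure_mono_null (fun a ha => ?_) (ae_iff.1 (ae_lt_of_essSup_lt (not_le.1 hc))))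
  exact not_lt.2 (h a ha)

theorem integral_sq_eq_zero_of_nonpos {Q : Measure A} {u : A → ℝ} (hu : Integrable u Q)
    (hu0 : ∫ a, u a ∂Q = 0) (h : ∀ᵐ a ∂Q, u a ≤ 0) : ∫ a, u a ^ 2 ∂Q = 0 := by
  have : ∀ᵐ a ∂Q, -u a = 0 := by
    refine (integral_eq_zero_iff_of_nonneg_ae (h.mono fun a ha => ?_) hu.neg).1 ?_
    · simpa using ha
    · simp [integral_neg, hu0]
  rw [← integral_zero A ℝ (μ := Q)]
  refine integral_congr_ae (this.mono fun a ha => ?_)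
  simp [neg_eq_zero.1 ha]

/-- Otherwise `u ≤ 1 / (n + 1)` a.e. for all `n`, so `u ≤ 0` a.e., and mean zero then forces `u = 0`
a.e. -/
theorem exists_measure_gt_ne_zero {Q : Measure A} {u : A → ℝ} (hu : Integrable u Q)
    (hu0 : ∫ a, u a ∂Q = 0) (hs : ∫ a, u a ^ 2 ∂Q ≠ 0) :
    ∃ ε : ℝ, 0 < ε ∧ Q {a | ε < u a} ≠ 0 := by
  by_contra! H
  refine hs (integral_sq_eq_zero_of_nonpos hu hu0 ?_)
  have : ∀ n : ℕ, ∀ᵐ a ∂Q, u a ≤ 1 / ((n : ℝ) + 1) := fun n => by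
    rw [ae_iff]
    simpa using H (1 / ((n : ℝ) + 1)) (by positivity)
  filter_upwards [ae_all_iff.2 this] with a ha
  exact ge_of_tendsto' tendsto_one_div_add_atTop_nhds_zero_nat ha

theorem tendsto_coe_mul_of_eventuallyEq {D : ℝ → EReal} {X : ℝ → ℝ} {x : ℝ}
    (h : ∀ᶠ t in 𝓝[>] (0 : ℝ), D t = (X t : EReal))
    (hX : Tendsto (fun t => X t / t ^ 2) (𝓝[>] 0) (𝓝 x)) :
    Tendsto (fun t : ℝ => ((1 / t ^ 2 : ℝ) : EReal) * D t) (𝓝[>] 0) (𝓝 (x : EReal)) := by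
  refine ((continuous_coe_real_ereal.tendsto x).comp hX).congr' ?_
  filter_upwards [h] with t ht
  rw [ht, ← EReal.coe_mul, Function.comp_apply, div_eq_mul_one_div, mul_comm]

/-- A lower bound of first order in `t` beats the normalisation `t²`. -/
theorem tendsto_coe_mul_top {D : ℝ → EReal} {b ε : ℝ} (hb : 1 < b) (hε : 0 < ε)
    (h : ∀ᶠ t in 𝓝[>] (0 : ℝ), ((Real.logb b (1 + t * ε) : ℝ) : EReal) ≤ D t) :
    Tendsto (fun t : ℝ => ((1 / t ^ 2 : ℝ) : EReal) * D t) (𝓝[>] 0) (𝓝 ⊤) := by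
  have hlb : 0 < Real.log b := Real.log_pos hb
  have hlow : Tendsto (fun t : ℝ => ε / (1 + ε) / Real.log b * t⁻¹) (𝓝[>] 0) atTop :=
    tendsto_inv_nhdsGT_zero.const_mul_atTop (by positivity)
  have hlow' := EReal.tendsto_coe_nhds_top_iff.2 hlow
  refine tendsto_nhds_top_mono hlow' ?_
  filter_upwards [h, Ioo_mem_nhdsGT (zero_lt_one' ℝ)] with t ht ht01
  obtain ⟨ht0, ht1⟩ := ht01
  refine le_trans ?_ (mul_le_mul_of_nonneg_left ht (by positivity))
  rw [← EReal.coe_mul, EReal.coe_le_coe_iff, Real.logb]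
  -- From `log x ≥ 1 - 1 / x`, with `1 + t ε ≤ 1 + ε` in the denominator because `t < 1`.
  have h1 : ε / (1 + ε) * t ≤ Real.log (1 + t * ε) := by
    refine le_trans ?_ (Real.one_sub_inv_le_log_of_pos (by positivity))
    have : 1 - (1 + t * ε)⁻¹ = ε * t / (1 + t * ε) := by
      field_simp
      ring
    rw [this, div_mul_eq_mul_div]
    refine div_le_div_of_nonneg_left (by positivity) (by positivity) ?_
    nlinarith
  calc ε / (1 + ε) / Real.log b * t⁻¹ = 1 / t ^ 2 * (ε / (1 + ε) * t / Real.log b) := by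
        field_simp
    _ ≤ _ := by gcongr

/-! ### The perturbed measure `(1 + t u) Q` -/

theorem eventually_perturbation_mem_Icc {A : Type*} {u : A → ℝ} {M : ℝ} (hM : ∀ a, |u a| ≤ M) :
    ∀ᶠ t in 𝓝[>] (0 : ℝ), ∀ a, 1 + t * u a ∈ Icc (1 / 2 : ℝ) (3 / 2) := by
  have h : ∀ᶠ t in 𝓝[>] (0 : ℝ), t * M < 1 / 2 := by
    have : Tendsto (fun t : ℝ => t * M) (𝓝[>] 0) (𝓝 (0 * M)) :=
      (tendsto_id.mul_const M).mono_left nhdsWithin_le_nhds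
    rw [zero_mul] at this
    exact this.eventually (gt_mem_nhds (by norm_num))
  filter_upwards [h, self_mem_nhdsWithin] with t ht ht0 a
  have ht0 : 0 < t := ht0
  have : |t * u a| ≤ 1 / 2 := by
    rw [abs_mul, abs_of_pos ht0]
    exact (mul_le_mul_of_nonneg_left (hM a) ht0.le).trans ht.le
  have := abs_le.1 this
  constructor <;> linarith

/-- This presents `Q` as a density over the perturbed measure, so the formulas for `k ν` against `ν`
also cover divergences with the arguments swapped. -/
theorem withDensity_perturbation_inv {Q : Measure A} {u : A → ℝ} (hu : Measurable u) {t : ℝ}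
    (ht : ∀ a, 0 < 1 + t * u a) :
    (Q.withDensity fun a => ENNReal.ofReal (1 + t * u a)).withDensity
      (fun a => ENNReal.ofReal (1 + t * u a)⁻¹) = Q := by
  rw [withDensity_ofReal_mul Q (by fun_prop) (g := fun a => (1 + t * u a)⁻¹) (by fun_prop)
    fun a => (ht a).le]
  simp [mul_inv_cancel₀ (ht _).ne', ← Pi.one_def]

section Perturbation

variable {Q : Measure A} [IsProbabilityMeasure Q] {u : A → ℝ} {M b : ℝ}

theorem integrable_comp_of_mem_Icc {h : A → ℝ} {φ : ℝ → ℝ} {x y : ℝ} (hh : Measurable h)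
    (hmem : ∀ a, h a ∈ Icc x y) (hφm : Measurable φ) (hφ : ContinuousOn φ (Icc x y)) :
    Integrable (fun a => φ (h a)) Q := by
  obtain ⟨C, hC⟩ := isCompact_Icc.exists_bound_of_continuousOn hφ
  exact Integrable.of_bound (hφm.comp hh).aestronglyMeasurable C (ae_of_all _ fun a => hC _ (hmem a))

theorem tendsto_integral_perturbation (hu : Measurable u) (hM : ∀ a, |u a| ≤ M)
    (hu0 : ∫ a, u a ∂Q = 0) {φ φ' : ℝ → ℝ} {c : ℝ} (hφm : Measurable φ)
    (h1 : ∀ x, 0 < x → HasDerivAt φ (φ' x) x) (h2 : HasDerivAt φ' c 1) :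
    Tendsto (fun t : ℝ => (∫ a, φ (1 + t * u a) ∂Q - φ 1) / t ^ 2) (𝓝[>] 0)
      (𝓝 (c / 2 * ∫ a, u a ^ 2 ∂Q)) := by
  refine tendsto_integral_second_order hu hM hu0 h1 h2 ?_
  filter_upwards [eventually_perturbation_mem_Icc hM] with t ht
  refine integrable_comp_of_mem_Icc (by fun_prop) ht hφm fun x hx => ?_
  exact (h1 x (lt_of_lt_of_le (by norm_num) hx.1)).continuousAt.continuousWithinAt

/-- Used with `β = α` and `β = 1 - α`, for which `β (β - 1)` is the same number `α (α - 1)`. -/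
theorem tendsto_log_integral_rpow (hu : Measurable u) (hM : ∀ a, |u a| ≤ M)
    (hu0 : ∫ a, u a ∂Q = 0) (β : ℝ) :
    Tendsto (fun t : ℝ => Real.log (∫ a, (1 + t * u a) ^ β ∂Q) / t ^ 2) (𝓝[>] 0)
      (𝓝 (β * (β - 1) / 2 * ∫ a, u a ^ 2 ∂Q)) ∧
    ∀ᶠ t in 𝓝[>] (0 : ℝ), 0 < ∫ a, (1 + t * u a) ^ β ∂Q := by
  have h := tendsto_integral_perturbation (Q := Q) hu hM hu0 (φ := fun x => x ^ β)
    (φ' := fun x => β * x ^ (β - 1)) (c := β * (β - 1)) (by fun_prop)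
    (fun x hx => Real.hasDerivAt_rpow_const (Or.inl hx.ne'))
    (by
      have := (Real.hasDerivAt_rpow_const (x := 1) (p := β - 1) (Or.inl one_ne_zero)).const_mul β
      simpa using this)
  simp only [Real.one_rpow] at h
  refine tendsto_log_div_of_tendsto_sub_one_div ?_ ?_ h
  · have : Tendsto (fun t : ℝ => t ^ 2) (𝓝 0) (𝓝 (0 ^ 2)) := (continuous_pow 2).tendsto 0
    rw [zero_pow two_ne_zero] at this
    exact this.mono_left nhdsWithin_le_nhds
  · filter_upwards [self_mem_nhdsWithin] with t ht
    exact pow_pos ht 2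

theorem isProbabilityMeasure_perturbation (hu : Integrable u Q) (hu0 : ∫ a, u a ∂Q = 0) {t : ℝ}
    (ht : ∀ a, 0 ≤ 1 + t * u a) :
    IsProbabilityMeasure (Q.withDensity fun a => ENNReal.ofReal (1 + t * u a)) := by
  constructor
  have hi : Integrable (fun a => 1 + t * u a) Q := (integrable_const 1).add (hu.const_mul t)
  rw [withDensity_apply _ MeasurableSet.univ, Measure.restrict_univ,
    ← ofReal_integral_eq_lintegral_ofReal hi (ae_of_all _ ht), integral_add (integrable_const 1) (hu.const_mul t), integral_const_mul, hu0]
  simp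

theorem tendsto_renyiDiv_perturbation_left (hu : Measurable u) (hM : ∀ a, |u a| ≤ M)
    (hu0 : ∫ a, u a ∂Q = 0) {α : ℝ≥0∞} (ht : α ≠ ∞) :
    Tendsto (fun t : ℝ => ((1 / t ^ 2 : ℝ) : EReal) *
      renyiDiv b α (Q.withDensity fun a => ENNReal.ofReal (1 + t * u a)) Q) (𝓝[>] 0)
      (𝓝 ((1 / 2 * α.toReal * ∫ a, u a ^ 2 ∂Q) * Real.logb b (Real.exp 1) : ℝ)) := by
  have hui : Integrable u Q := Integrable.of_bound hu.aestronglyMeasurable M (ae_of_all _ hM)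
  have hmeas : ∀ t : ℝ, Measurable fun a => 1 + t * u a := fun t => by fun_prop
  rcases eq_or_ne α 0 with rfl | h0
  · refine tendsto_coe_mul_of_eventuallyEq (X := fun _ => 0) ?_ (by simp)
    filter_upwards [eventually_perturbation_mem_Icc hM] with t ht
    rw [renyiDiv_withDensity_zero (hmeas t) fun a => one_half_pos.trans_le (ht a).1]
    rfl
  rcases eq_or_ne α 1 with rfl | h1
  · have h := tendsto_integral_perturbation (Q := Q) hu hM hu0
      InformationTheory.measurable_klFun
      (fun x hx => InformationTheory.hasDerivAt_klFun hx.ne') (c := 1)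
      (by simpa using Real.hasDerivAt_log one_ne_zero)
    refine tendsto_coe_mul_of_eventuallyEq (X := fun t => Real.logb b (Real.exp 1) *
      ∫ a, InformationTheory.klFun (1 + t * u a) ∂Q) ?_ ?_
    · filter_upwards [eventually_perturbation_mem_Icc hM] with t ht
      have hpos : ∀ a, 0 < 1 + t * u a := fun a => one_half_pos.trans_le (ht a).1
      have := isProbabilityMeasure_perturbation hui hu0 fun a => (hpos a).le
      exact renyiDiv_withDensity_one (hmeas t) hpos
        (integrable_comp_of_mem_Icc (hmeas t) ht InformationTheory.measurable_klFun
          InformationTheory.continuous_klFun.continuousOn)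
    · simp only [InformationTheory.klFun_one, sub_zero] at h
      convert h.const_mul (Real.logb b (Real.exp 1)) using 2
      · ring
      · simp; ring
  · have hα : α.toReal - 1 ≠ 0 := by
      rw [sub_ne_zero]
      simpa [ENNReal.toReal_eq_one_iff] using h1
    obtain ⟨h, hpos⟩ := tendsto_log_integral_rpow (Q := Q) hu hM hu0 α.toReal
    refine tendsto_coe_mul_of_eventuallyEq (X := fun t => (α.toReal - 1)⁻¹ *
      Real.logb b (∫ a, (1 + t * u a) ^ α.toReal ∂Q)) ?_ ?_
    · filter_upwards [eventually_perturbation_mem_Icc hM, hpos] with t hI hp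
      have hpos : ∀ a, 0 < 1 + t * u a := fun a => one_half_pos.trans_le (hI a).1
      refine renyiDiv_withDensity h0 h1 ht (hmeas t) hpos ?_ hp
      exact integrable_comp_of_mem_Icc (φ := fun x => x ^ α.toReal) (hmeas t) hI (by fun_prop)
        (fun x hx => (Real.continuousAt_rpow_const _ _
          (Or.inl (one_half_pos.trans_le hx.1).ne')).continuousWithinAt)
    · convert h.const_mul ((α.toReal - 1)⁻¹ * (Real.log b)⁻¹) using 2
      · rw [Real.logb]; ring
      · rw [Real.logb, Real.log_exp]
        field_simp

theorem tendsto_renyiDiv_perturbation_right (hu : Measurable u) (hM : ∀ a, |u a| ≤ M)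
    (hu0 : ∫ a, u a ∂Q = 0) {α : ℝ≥0∞} (ht : α ≠ ∞) :
    Tendsto (fun t : ℝ => ((1 / t ^ 2 : ℝ) : EReal) *
      renyiDiv b α Q (Q.withDensity fun a => ENNReal.ofReal (1 + t * u a))) (𝓝[>] 0)
      (𝓝 ((1 / 2 * α.toReal * ∫ a, u a ^ 2 ∂Q) * Real.logb b (Real.exp 1) : ℝ)) := by
  have hui : Integrable u Q := Integrable.of_bound hu.aestronglyMeasurable M (ae_of_all _ hM)
  have hmeas : ∀ t : ℝ, Measurable fun a => 1 + t * u a := fun t => by fun_prop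
  have hmeas' : ∀ t : ℝ, Measurable fun a => (1 + t * u a)⁻¹ := fun t => by fun_prop
  have hR : ∀ t, (∀ a, 1 + t * u a ∈ Icc (1 / 2 : ℝ) (3 / 2)) →
      IsProbabilityMeasure (Q.withDensity fun a => ENNReal.ofReal (1 + t * u a)) := fun t hI =>
    isProbabilityMeasure_perturbation hui hu0 fun a => (one_half_pos.trans_le (hI a).1).le
  rcases eq_or_ne α 0 with rfl | h0
  · refine tendsto_coe_mul_of_eventuallyEq (X := fun _ => 0) ?_ (by simp)
    filter_upwards [eventually_perturbation_mem_Icc hM] with t hI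
    have hpos : ∀ a, 0 < 1 + t * u a := fun a => one_half_pos.trans_le (hI a).1
    have := hR t hI
    have h := renyiDiv_withDensity_zero (b := b)
      (ν := Q.withDensity fun a => ENNReal.ofReal (1 + t * u a)) (hmeas' t)
      fun a => inv_pos.2 (hpos a)
    rwa [withDensity_perturbation_inv hu hpos] at h
  rcases eq_or_ne α 1 with rfl | h1
  · have h := tendsto_integral_perturbation (Q := Q) hu hM hu0
      (φ := fun x => x - 1 - Real.log x) (φ' := fun x => 1 - x⁻¹) (c := 1) (by fun_prop)
      (fun x hx => by
        exact ((hasDerivAt_id x).sub_const 1).sub (Real.hasDerivAt_log hx.ne'))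
      (by simpa using (hasDerivAt_inv (one_ne_zero (α := ℝ))).const_sub 1)
    -- The weight `x` comes from integrating against the perturbed measure; the resulting function
    -- again has second derivative `1` at `1`.
    have hkl : ∀ x : ℝ, 0 < x → x * InformationTheory.klFun x⁻¹ = x - 1 - Real.log x := by
      intro x hx
      rw [InformationTheory.klFun_apply, Real.log_inv]
      field_simp
      ring
    refine tendsto_coe_mul_of_eventuallyEq (X := fun t => Real.logb b (Real.exp 1) *
      ∫ a, (1 + t * u a - 1 - Real.log (1 + t * u a)) ∂Q) ?_ ?_
    · filter_upwards [eventually_perturbation_mem_Icc hM] with t hI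
      have hpos : ∀ a, 0 < 1 + t * u a := fun a => one_half_pos.trans_le (hI a).1
      have := hR t hI
      have heq : (fun a => (1 + t * u a) * InformationTheory.klFun (1 + t * u a)⁻¹) =
          fun a => 1 + t * u a - 1 - Real.log (1 + t * u a) := by
        ext a
        exact hkl _ (hpos a)
      have hfin : IsFiniteMeasure ((Q.withDensity fun a => ENNReal.ofReal (1 + t * u a)).withDensity
          (fun a => ENNReal.ofReal (1 + t * u a)⁻¹)) := by
        rw [withDensity_perturbation_inv hu hpos]
        infer_instance
      have h := renyiDiv_withDensity_one (b := b)
        (ν := Q.withDensity fun a => ENNReal.ofReal (1 + t * u a)) (hmeas' t)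
        (fun a => inv_pos.2 (hpos a)) (by
          rw [integrable_withDensity_ofReal_iff Q (hmeas t) fun a => (hpos a).le, heq]
          refine integrable_comp_of_mem_Icc (φ := fun x => x - 1 - Real.log x) (hmeas t) hI
            (by fun_prop) fun x hx => ?_
          have : x ≠ 0 := (one_half_pos.trans_le hx.1).ne'
          fun_prop (disch := assumption))
      rwa [withDensity_perturbation_inv hu hpos,
        integral_withDensity_ofReal Q _ (hmeas t) fun a => (hpos a).le, heq] at h
    · simp only [Real.log_one, sub_self, sub_zero] at h
      convert h.const_mul (Real.logb b (Real.exp 1)) using 2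
      · ring
      · simp; ring
  · have hα : α.toReal - 1 ≠ 0 := by
      rw [sub_ne_zero]
      simpa [ENNReal.toReal_eq_one_iff] using h1
    obtain ⟨h, hpos⟩ := tendsto_log_integral_rpow (Q := Q) hu hM hu0 (1 - α.toReal)
    refine tendsto_coe_mul_of_eventuallyEq (X := fun t => (α.toReal - 1)⁻¹ *
      Real.logb b (∫ a, (1 + t * u a) ^ (1 - α.toReal) ∂Q)) ?_ ?_
    · filter_upwards [eventually_perturbation_mem_Icc hM, hpos] with t hI hp
      have hpos : ∀ a, 0 < 1 + t * u a := fun a => one_half_pos.trans_le (hI a).1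
      have := hR t hI
      have heq : (fun a => (1 + t * u a) * (1 + t * u a)⁻¹ ^ α.toReal) =
          fun a => (1 + t * u a) ^ (1 - α.toReal) := by
        ext a
        rw [Real.rpow_sub (hpos a), Real.rpow_one, Real.inv_rpow (hpos a).le, div_eq_mul_inv]
      have hint : ∫ a, (1 + t * u a)⁻¹ ^ α.toReal
          ∂(Q.withDensity fun a => ENNReal.ofReal (1 + t * u a)) =
          ∫ a, (1 + t * u a) ^ (1 - α.toReal) ∂Q := by
        rw [integral_withDensity_ofReal Q _ (hmeas t) fun a => (hpos a).le, heq]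
      have h := renyiDiv_withDensity (b := b) h0 h1 ht
        (ν := Q.withDensity fun a => ENNReal.ofReal (1 + t * u a)) (hmeas' t)
        (fun a => inv_pos.2 (hpos a)) (by
          rw [integrable_withDensity_ofReal_iff Q (hmeas t) fun a => (hpos a).le, heq]
          exact integrable_comp_of_mem_Icc (φ := fun x => x ^ (1 - α.toReal)) (hmeas t) hI
            (by fun_prop) (fun x hx => (Real.continuousAt_rpow_const _ _
              (Or.inl (one_half_pos.trans_le hx.1).ne')).continuousWithinAt)) (by rwa [hint])
      rwa [withDensity_perturbation_inv hu hpos, hint] at h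
    · convert h.const_mul ((α.toReal - 1)⁻¹ * (Real.log b)⁻¹) using 2
      · rw [Real.logb]; ring
      · rw [Real.logb, Real.log_exp]
        field_simp
        ring

theorem elogb_mono (hb : 1 < b) : Monotone (elogb b) := fun _ _ h =>
  mul_le_mul_of_nonneg_left (ENNReal.log_monotone h)
    (EReal.coe_nonneg.2 (inv_nonneg.2 (Real.log_pos hb).le))

theorem elogb_one : elogb b 1 = 0 := by simp [elogb]

theorem tendsto_renyiDiv_top_perturbation_left (hb : 1 < b) (hu : Measurable u)
    (hM : ∀ a, |u a| ≤ M) (hu0 : ∫ a, u a ∂Q = 0) (hs : ∫ a, u a ^ 2 ∂Q ≠ 0) :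
    Tendsto (fun t : ℝ => ((1 / t ^ 2 : ℝ) : EReal) *
      renyiDiv b ∞ (Q.withDensity fun a => ENNReal.ofReal (1 + t * u a)) Q) (𝓝[>] 0) (𝓝 ⊤) := by
  have hui : Integrable u Q := Integrable.of_bound hu.aestronglyMeasurable M (ae_of_all _ hM)
  obtain ⟨ε, hε, hQ⟩ := exists_measure_gt_ne_zero hui hu0 hs
  refine tendsto_coe_mul_top hb hε ?_
  filter_upwards [eventually_perturbation_mem_Icc hM, self_mem_nhdsWithin] with t hI ht0
  have ht0 : 0 < t := ht0
  rw [renyiDiv_withDensity_top (by fun_prop) fun a => one_half_pos.trans_le (hI a).1,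
    ← elogb_ofReal (by positivity)]
  refine elogb_mono hb (le_essSup_of_measure_ne_zero hQ fun a ha => ENNReal.ofReal_le_ofReal ?_)
  have : ε < u a := ha
  gcongr

theorem tendsto_renyiDiv_top_perturbation_right (hb : 1 < b) (hu : Measurable u)
    (hM : ∀ a, |u a| ≤ M) (hu0 : ∫ a, u a ∂Q = 0) (hs : ∫ a, u a ^ 2 ∂Q ≠ 0) :
    Tendsto (fun t : ℝ => ((1 / t ^ 2 : ℝ) : EReal) *
      renyiDiv b ∞ Q (Q.withDensity fun a => ENNReal.ofReal (1 + t * u a))) (𝓝[>] 0) (𝓝 ⊤) := by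
  have hui : Integrable u Q := Integrable.of_bound hu.aestronglyMeasurable M (ae_of_all _ hM)
  -- The density of `Q` over the perturbed measure is `1 / (1 + t u)`, which exceeds `1` where `u`
  -- is negative.
  obtain ⟨ε, hε, hQ⟩ := exists_measure_gt_ne_zero (u := fun a => -u a) hui.neg
    (by rw [integral_neg, hu0, neg_zero]) (by simpa using hs)
  refine tendsto_coe_mul_top hb hε ?_
  filter_upwards [eventually_perturbation_mem_Icc hM, self_mem_nhdsWithin] with t hI ht0
  have ht0 : 0 < t := ht0
  have hpos : ∀ a, 0 < 1 + t * u a := fun a => one_half_pos.trans_le (hI a).1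
  have := isProbabilityMeasure_perturbation hui hu0 fun a => (hpos a).le
  have h := renyiDiv_withDensity_top (b := b)
    (ν := Q.withDensity fun a => ENNReal.ofReal (1 + t * u a)) (k := fun a => (1 + t * u a)⁻¹)
    (by fun_prop) fun a => inv_pos.2 (hpos a)
  rw [withDensity_perturbation_inv hu hpos] at h
  have hac : Q ≪ Q.withDensity fun a => ENNReal.ofReal (1 + t * u a) :=
    withDensity_absolutelyContinuous' (by fun_prop)
      (ae_of_all _ fun a => (ENNReal.ofReal_pos.2 (hpos a)).ne')
  rw [h, ← elogb_ofReal (by positivity)]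
  refine elogb_mono hb (le_essSup_of_measure_ne_zero (fun h0 => hQ (hac h0))
    fun a ha => ENNReal.ofReal_le_ofReal ?_)
  have ha : ε < -u a := ha
  rw [← one_div, le_div_iff₀ (hpos a)]
  have : t * ε ≤ t * -u a := by gcongr
  -- Here `(1 + t ε)(1 + t u) ≤ (1 + t ε)(1 - t ε) ≤ 1`.
  nlinarith [mul_pos ht0 hε, sq_nonneg (t * ε)]

/-- The integrands `g² - 1` and `(g - 1)²` differ by `2 (g - 1)`, which has integral zero. As `g`
may vanish, the limit of `t² - 1` at zero must be identified. -/
theorem chiSqDiv_withDensity {g : A → ℝ} (hg : Measurable g) (hg0 : ∀ a, 0 ≤ g a)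
    (hgM : ∀ a, g a ≤ M) (hg1 : ∫ a, g a ∂Q = 1) :
    chiSqDiv (Q.withDensity fun a => ENNReal.ofReal (g a)) Q =
      ((∫ a, (g a - 1) ^ 2 ∂Q : ℝ) : EReal) := by
  have hgi : Integrable g Q := Integrable.of_bound hg.aestronglyMeasurable M
    (ae_of_all _ fun a => by rw [Real.norm_of_nonneg (hg0 a)]; exact hgM a)
  have hg2 : Integrable (fun a => g a ^ 2) Q :=
    integrable_comp_of_mem_Icc hg (fun a => ⟨hg0 a, hgM a⟩) (measurable_id.pow_const 2)
      (continuous_pow 2).continuousOn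
  have hf : (fun t : ℝ => (t ^ (2 : ℝ) - 1) / (2 - 1)) = fun t => t ^ 2 - 1 := by
    ext t
    rw [Real.rpow_two]
    norm_num
  have hval : valueAtZero (fun t => t ^ 2 - 1) = (((0 : ℝ) ^ 2 - 1 : ℝ) : EReal) := by
    refine Tendsto.limUnder_eq ?_
    have : Continuous fun t : ℝ => ((t ^ 2 - 1 : ℝ) : EReal) :=
      continuous_coe_real_ereal.comp (by fun_prop)
    exact (this.tendsto 0).mono_left nhdsWithin_le_nhds
  rw [chiSqDiv, hellingerDiv, hf,
    fDiv_withDensity hg hg0 (hg2.sub (integrable_const 1)) (Or.inr hval)]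
  congr 1
  have e : ∀ a, (g a - 1) ^ 2 = g a ^ 2 - 1 - 2 * (g a - 1) := fun a => by ring
  have i1 : Integrable (fun a => g a ^ 2 - 1) Q := hg2.sub (integrable_const 1)
  have i2 : Integrable (fun a => 2 * (g a - 1)) Q := (hgi.sub (integrable_const 1)).const_mul 2
  simp_rw [e]
  rw [integral_sub i1 i2, integral_const_mul, integral_sub hgi (integrable_const 1), hg1]
  simp

end Perturbation

end FDivergence

end

/-! ### The theorem -/

theorem corollary5 {A : Type*} [MeasurableSpace A]
    (P Q : MeasureTheory.Measure A)
    [MeasureTheory.IsProbabilityMeasure P] [MeasureTheory.IsProbabilityMeasure Q]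
    (hPQ : P.AbsolutelyContinuous Q)
    (hbdd : essSup (P.rnDeriv Q) Q < ∞)
    (b : ℝ) (hb : 1 < b) (α : ℝ≥0∞) :
    Tendsto
        (fun t : ℝ => ((1 / t ^ 2 : ℝ) : EReal) *
          FDivergence.renyiDiv b α (FDivergence.mixture t P Q) Q)
        (𝓝[>] 0)
        (𝓝 (((1 / 2 : ℝ) : EReal) * (α : EReal) * FDivergence.chiSqDiv P Q *
          ((Real.logb b (Real.exp 1) : ℝ) : EReal))) ∧
      Tendsto
        (fun t : ℝ => ((1 / t ^ 2 : ℝ) : EReal) *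
          FDivergence.renyiDiv b α Q (FDivergence.mixture t P Q))
        (𝓝[>] 0)
        (𝓝 (((1 / 2 : ℝ) : EReal) * (α : EReal) * FDivergence.chiSqDiv P Q *
          ((Real.logb b (Real.exp 1) : ℝ) : EReal))) := by
  obtain ⟨g, M, hg, hg0, hgM, rfl⟩ := FDivergence.exists_bounded_density hPQ hbdd
  have hgi : Integrable g Q := Integrable.of_bound hg.aestronglyMeasurable M
    (ae_of_all _ fun a => by rw [Real.norm_of_nonneg (hg0 a)]; exact hgM a)
  have hg1 : ∫ a, g a ∂Q = 1 := by
    have := FDivergence.integral_withDensity_ofReal Q (fun _ => (1 : ℝ)) hg hg0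
    simpa using this.symm
  have hu : Measurable fun a => g a - 1 := by fun_prop
  have hM : ∀ a, |g a - 1| ≤ M + 1 := fun a => by
    rw [abs_le]
    constructor <;> linarith [hg0 a, hgM a]
  have hu0 : ∫ a, (g a - 1) ∂Q = 0 := by
    rw [integral_sub hgi (integrable_const 1), hg1]
    simp
  have hlog : 0 < Real.logb b (Real.exp 1) := by
    rw [Real.logb, Real.log_exp]
    exact one_div_pos.2 (Real.log_pos hb)
  have hmix : ∀ᶠ t in 𝓝[>] (0 : ℝ),
      FDivergence.mixture t (Q.withDensity fun a => ENNReal.ofReal (g a)) Q =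
        Q.withDensity fun a => ENNReal.ofReal (1 + t * (g a - 1)) := by
    filter_upwards [Ioo_mem_nhdsGT (zero_lt_one' ℝ)] with t ht
    exact FDivergence.mixture_withDensity Q hg hg0 ht.1.le ht.2.le
  rw [FDivergence.chiSqDiv_withDensity hg hg0 hgM hg1]
  have hleft : (fun t : ℝ => ((1 / t ^ 2 : ℝ) : EReal) * FDivergence.renyiDiv b α
      (FDivergence.mixture t (Q.withDensity fun a => ENNReal.ofReal (g a)) Q) Q) =ᶠ[𝓝[>] 0]
      fun t : ℝ => ((1 / t ^ 2 : ℝ) : EReal) * FDivergence.renyiDiv b α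
        (Q.withDensity fun a => ENNReal.ofReal (1 + t * (g a - 1))) Q :=
    hmix.mono fun t ht => by simp only [ht]
  have hright : (fun t : ℝ => ((1 / t ^ 2 : ℝ) : EReal) * FDivergence.renyiDiv b α Q
      (FDivergence.mixture t (Q.withDensity fun a => ENNReal.ofReal (g a)) Q)) =ᶠ[𝓝[>] 0]
      fun t : ℝ => ((1 / t ^ 2 : ℝ) : EReal) * FDivergence.renyiDiv b α Q
        (Q.withDensity fun a => ENNReal.ofReal (1 + t * (g a - 1))) :=
    hmix.mono fun t ht => by simp only [ht]
  rw [tendsto_congr' hleft, tendsto_congr' hright]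
  rcases eq_or_ne α ∞ with rfl | hα
  -- Zero chi-squared divergence means `g = 1` a.e.; every mixture is then `Q`, and the convention
  -- `∞ * 0 = 0` gives the right-hand side.
  · rcases eq_or_ne (∫ a, (g a - 1) ^ 2 ∂Q) 0 with hs | hs
    · have hae : ∀ᵐ a ∂Q, g a - 1 = 0 := by
        have hi : Integrable (fun a => (g a - 1) ^ 2) Q :=
          FDivergence.integrable_comp_of_mem_Icc (φ := fun x => x ^ 2) hu
            (fun a => abs_le.1 (hM a)) (by fun_prop) (by fun_prop)
        filter_upwards [(integral_eq_zero_iff_of_nonneg (fun a => sq_nonneg (g a - 1)) hi).1 hs]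
          with a ha
        simpa using ha
      have hR : ∀ t : ℝ, (Q.withDensity fun a => ENNReal.ofReal (1 + t * (g a - 1))) = Q := by
        intro t
        conv_rhs => rw [← withDensity_one (μ := Q)]
        exact withDensity_congr_ae (hae.mono fun a ha => by simp [ha])
      have hQQ : FDivergence.renyiDiv b ∞ Q Q = 0 := by
        have h := FDivergence.renyiDiv_withDensity_top (b := b) (ν := Q) (k := fun _ => 1)
          measurable_const fun _ => one_pos
        rwa [ENNReal.ofReal_one, ← Pi.one_def, withDensity_one, Pi.one_def,
          essSup_const _ (NeZero.ne Q), FDivergence.elogb_one] at h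
      simp only [hR, hQQ, hs]
      simp
    · have hspos : 0 < ∫ a, (g a - 1) ^ 2 ∂Q :=
        (integral_nonneg fun a => sq_nonneg _).lt_of_ne' hs
      rw [EReal.coe_ennreal_top, EReal.coe_mul_top_of_pos (by norm_num),
        EReal.top_mul_coe_of_pos hspos, EReal.top_mul_coe_of_pos hlog]
      exact ⟨FDivergence.tendsto_renyiDiv_top_perturbation_left hb hu hM hu0 hs,
        FDivergence.tendsto_renyiDiv_top_perturbation_right hb hu hM hu0 hs⟩
  · rw [← EReal.coe_ennreal_toReal hα, ← EReal.coe_mul, ← EReal.coe_mul, ← EReal.coe_mul]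
    exact ⟨FDivergence.tendsto_renyiDiv_perturbation_left hu hM hu0 hα,
      FDivergence.tendsto_renyiDiv_perturbation_right hu hM hu0 hα⟩
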